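/- Let $\delta\in(0,1)$ and let $K_\delta=\{x+iy: x,y\in\mathbb R,\ \frac{x^2}{(1+\delta)^2}+\frac{y^2}{(1-\delta)^2}\le 1\}$. Let $\mathcal H$ be a complex Hilbert space, let $T\in\mathcal B(\mathcal H)$ be a bounded linear operator with spectrum $\sigma(T)$ and numerical range $W(T)=\{\langle Tv,v\rangle: v\in\mathcal H,\ \|v\|=1\}$, and suppose that $T$ is generic for $K_\delta$, that is, $\dim\mathcal H<\infty$, $\sigma(T)\subseteq K_\delta$, $\sigma(T)$ consists of $\dim\mathcal H$ distinct points, and $4\delta\notin\sigma(T^2)$. Call $Q\in\mathcal B(\mathcal H)$ admissible if $QT=TQ$ and $Q^2=T^2-4\delta$, and for admissible $Q$ let $Z_T=\frac12\begin{bmatrix}T&Q\\Q&T\end{bmatrix}\in\mathcal B(\mathcal H\oplus\mathcal H)$ (orthogonal direct sum, operator norm). Then an admissible $Q$ exists; for every admissible $Q$ and every invertible $S\in\mathcal B(\mathcal H)$ the inequalities $$\text{(a)}\quad \left\|\begin{bmatrix}1&0\\0&S\end{bmatrix}Z_T\begin{bmatrix}1&0\\0&S\end{bmatrix}^{-1}\right\|\le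 1,\qquad \text{(b)}\quad \left\|\tfrac12\begin{bmatrix}T&QS^{-1}\\SQ&STS^{-1}\end{bmatrix}\right\|\le 1$$ are equivalent; and the following conditions are equivalent: 1. $W(T)\subseteq K_\delta$; 2. for some admissible $Q$ there is an invertible $S\in\mathcal B(\mathcal H)$ satisfying (a); 3. for every admissible $Q$ there is an invertible $S\in\mathcal B(\mathcal H)$ satisfying (a); 4. for some admissible $Q$ there is an invertible $S\in\mathcal B(\mathcal H)$ satisfying (b); 5. for every admissible $Q$ there is an invertible $S\in\mathcal B(\mathcal H)$ satisfying (b). -/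

import Mathlib

namespace EllipticalRange

/-- The closed elliptical set `K_δ = {x + iy : x²/(1+δ)² + y²/(1-δ)² ≤ 1}`. -/
def ellipse (δ : ℝ) : Set ℂ :=
  {z | z.re ^ 2 / (1 + δ) ^ 2 + z.im ^ 2 / (1 - δ) ^ 2 ≤ 1}

section Operators

variable {H : Type*} [NormedAddCommGroup H] [InnerProductSpace ℂ H]

/-- The numerical range `W(T) = {⟨Tv, v⟩ : ‖v‖ = 1}`. The inner product in Mathlib is linear in
the second argument, so the value written `⟨Tv, v⟩` (linear in `Tv`) is `inner ℂ v (T v)`. -/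
def numRange (T : H →L[ℂ] H) : Set ℂ :=
  {z | ∃ v : H, ‖v‖ = 1 ∧ z = inner ℂ v (T v)}

/-- `T` is generic for `K_δ`. -/
structure IsGeneric (δ : ℝ) (T : H →L[ℂ] H) : Prop where
  finiteDimensional : FiniteDimensional ℂ H
  spectrum_subset : spectrum ℂ T ⊆ ellipse δ
  card_spectrum : (spectrum ℂ T).ncard = Module.finrank ℂ H
  notMem_spectrum_sq : (4 * (δ : ℂ)) ∉ spectrum ℂ (T ^ 2)

/-- `Q` commutes with `T` and satisfies `Q² = T² - 4δ`. -/
structure IsRootChoice (δ : ℝ) (T Q : H →L[ℂ] H) : Prop where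
  commute : Q * T = T * Q
  sq_eq : Q ^ 2 = T ^ 2 - (4 * (δ : ℂ)) • (1 : H →L[ℂ] H)

/-- The operator with block matrix `[[A, B], [C, D]]` on the Hilbert space direct sum `H ⊕ H`. -/
noncomputable def block (A B C D : H →L[ℂ] H) :
    WithLp 2 (H × H) →L[ℂ] WithLp 2 (H × H) :=
  ((WithLp.prodContinuousLinearEquiv 2 ℂ H H).symm : H × H →L[ℂ] WithLp 2 (H × H)) ∘L
    ((A.coprod B).prod (C.coprod D)) ∘L
    (WithLp.prodContinuousLinearEquiv 2 ℂ H H : WithLp 2 (H × H) →L[ℂ] H × H)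

theorem block_apply (A B C D : H →L[ℂ] H) (x y : H) :
    block A B C D (WithLp.toLp 2 (x, y)) = WithLp.toLp 2 (A x + B y, C x + D y) := rfl

theorem block_diag_mul (S R : H →L[ℂ] H) (h : S * R = 1) :
    block 1 0 0 S * block 1 0 0 R = 1 := by
  ext v
  all_goals
    obtain ⟨x, y⟩ := v
    have hy : S (R y) = y := by
      rw [← mul_apply_eq_comp, h, one_apply_eq_self]
    simp [block_apply, hy]

/-- The operator `diag(1, S)` on `H ⊕ H`, for invertible `S`, as an invertible operator. -/
noncomputable def diagOne (S : (H →L[ℂ] H)ˣ) :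
    (WithLp 2 (H × H) →L[ℂ] WithLp 2 (H × H))ˣ where
  val := block 1 0 0 (S : H →L[ℂ] H)
  inv := block 1 0 0 ((S⁻¹ : (H →L[ℂ] H)ˣ) : H →L[ℂ] H)
  val_inv := block_diag_mul _ _ S.mul_inv
  inv_val := block_diag_mul _ _ S.inv_mul

/-- The operator `Z_T = ½ [[T, Q], [Q, T]]` on `H ⊕ H`. -/
noncomputable def zOp (T Q : H →L[ℂ] H) : WithLp 2 (H × H) →L[ℂ] WithLp 2 (H × H) :=
  (1 / 2 : ℂ) • block T Q Q T

/-- `‖diag(1, S) Z_T diag(1, S)⁻¹‖ ≤ 1`. -/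
def IsContractiveConj (T Q : H →L[ℂ] H) (S : (H →L[ℂ] H)ˣ) : Prop :=
  ‖(diagOne S : WithLp 2 (H × H) →L[ℂ] WithLp 2 (H × H)) * zOp T Q *
    ((diagOne S)⁻¹ : (WithLp 2 (H × H) →L[ℂ] WithLp 2 (H × H))ˣ)‖ ≤ 1

/-- `‖½ [[T, Q S⁻¹], [S Q, S T S⁻¹]]‖ ≤ 1`. -/
def IsContractiveBlock (T Q : H →L[ℂ] H) (S : (H →L[ℂ] H)ˣ) : Prop :=
  ‖(1 / 2 : ℂ) • block T (Q * ((S⁻¹ : (H →L[ℂ] H)ˣ) : H →L[ℂ] H))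
    ((S : H →L[ℂ] H) * Q)
    ((S : H →L[ℂ] H) * T * ((S⁻¹ : (H →L[ℂ] H)ˣ) : H →L[ℂ] H))‖ ≤ 1

end Operators

end EllipticalRange

/-! Each condition says that `T/2` is a compression of a contraction `R` on `H ⊕ H` with `R² = δ`.

Multiplying out (a) gives exactly (b). Right multiplication by diag(1, -1) turns the matrix in (b)
into such an `R`. As `R² = δ`, the products `RR*` and `R*R` commute and multiply to `δ²`, so `(1 -
RR*)(1 - R*R) ≥ 0`, that is, `RR* + R*R ≤ 1 + δ²`. Testing this bound in the direction normal to the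
ellipse puts `2⟨Rv, v⟩` in `K_δ` (`two_smul_inner_mem_ellipse`).

Conversely, `z ↦ z - δ z̄` maps `K_δ` onto the disc of radius `1 - δ²`, so `V = (T - δT*)/(2(1 -
δ²))` has numerical radius at most `1/2`. Operator Fejér–Riesz in degree one
(`exists_factor_of_numerical_radius_le`) gives `V = F*G` with `F*F + G*G = 1`. The isometry `x ↦
(Fx, Gx)` compresses `[[0, 1], [δ, 0]]` to `F*G + δG*F = T/2`; extended to a unitary, it yields `R =
[[T/2, B], [C, D]]`. Then `R² = δ` forces `BC = -Q²/4` and `DC = -CT/2`. Since `4δ ∉ σ(T²)`, every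
admissible `Q` is invertible, hence so is `C`, and `S = 2CQ⁻¹` satisfies (b). This works for any
`Q`, so "some" and "every" agree. -/

namespace EllipticalRange

open ContinuousLinearMap Polynomial

/-! ### Contractions whose square is a scalar -/

section QuadraticContraction

variable {E : Type*} [NormedAddCommGroup E] [InnerProductSpace ℂ E] [CompleteSpace E]

theorem mul_star_le_one_of_norm_le_one {R : E →L[ℂ] E} (h : ‖R‖ ≤ 1) : R * star R ≤ 1 :=
  (CStarAlgebra.norm_le_one_iff_of_nonneg _ (mul_star_self_nonneg R)).1
    ((CStarRing.norm_self_mul_star (x := R)).trans_le (mul_le_one₀ h (norm_nonneg R) h))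

theorem norm_sq_add_norm_adjoint_sq_le {δ : ℝ} {R : E →L[ℂ] E}
    (hR : R * R = (δ : ℂ) • (1 : E →L[ℂ] E)) (hn : ‖R‖ ≤ 1) (v : E) :
    ‖R v‖ ^ 2 + ‖star R v‖ ^ 2 ≤ (1 + δ ^ 2) * ‖v‖ ^ 2 := by
  have hR' : star R * star R = (δ : ℂ) • (1 : E →L[ℂ] E) := by
    rw [← star_mul, hR, star_smul, star_one]
    simp
  have h1 : (0 : E →L[ℂ] E) ≤ 1 - R * star R :=
    sub_nonneg.2 (mul_star_le_one_of_norm_le_one hn)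
  have h2 : (0 : E →L[ℂ] E) ≤ 1 - star R * R := by
    have := mul_star_le_one_of_norm_le_one (R := star R) (by rwa [norm_star])
    rw [star_star] at this
    exact sub_nonneg.2 this
  have e1 : (R * star R) * (star R * R) = ((δ : ℂ) ^ 2) • (1 : E →L[ℂ] E) := by
    rw [mul_assoc, ← mul_assoc (star R) (star R) R, hR']
    simp [hR, smul_smul, sq, -Complex.coe_smul]
  have e2 : (star R * R) * (R * star R) = ((δ : ℂ) ^ 2) • (1 : E →L[ℂ] E) := by
    rw [mul_assoc, ← mul_assoc R R (star R), hR]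
    simp [hR', smul_smul, sq, -Complex.coe_smul]
  have hc : Commute (1 - R * star R) (1 - star R * R) := by
    change _ * _ = _ * _
    simp only [sub_mul, mul_sub, one_mul, mul_one, e1, e2]
    abel
  have h3 := Commute.mul_nonneg h1 h2 hc
  have e3 : (1 - R * star R) * (1 - star R * R)
      = (1 : E →L[ℂ] E) - R * star R - star R * R + ((δ : ℂ) ^ 2) • (1 : E →L[ℂ] E) := by
    simp only [sub_mul, mul_sub, one_mul, mul_one, e1]
    abel
  rw [e3] at h3
  have h4 := ((ContinuousLinearMap.nonneg_iff_isPositive _).1 h3).re_inner_nonneg_right v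
  have i1 : inner ℂ v (R (star R v)) = (‖star R v‖ : ℂ) ^ 2 := by
    rw [star_eq_adjoint, ← adjoint_inner_left, inner_self_eq_norm_sq_to_K]
    rfl
  have i2 : inner ℂ v (star R (R v)) = (‖R v‖ : ℂ) ^ 2 := by
    rw [star_eq_adjoint, adjoint_inner_right, inner_self_eq_norm_sq_to_K]
    rfl
  have i3 : inner ℂ v v = (‖v‖ : ℂ) ^ 2 := inner_self_eq_norm_sq_to_K v
  simp only [add_apply, sub_apply, mul_apply_eq_comp, one_apply_eq_self, smul_apply,
    inner_add_right, inner_sub_right, inner_smul_right, i1, i2, i3] at h4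
  norm_cast at h4
  change 0 ≤ ‖v‖ ^ 2 - ‖star R v‖ ^ 2 - ‖R v‖ ^ 2 + δ ^ 2 * ‖v‖ ^ 2 at h4
  linarith

theorem two_smul_inner_mem_ellipse {δ : ℝ} (hδ₀ : 0 < δ) (hδ₁ : δ < 1) {R : E →L[ℂ] E}
    (hR : R * R = (δ : ℂ) • (1 : E →L[ℂ] E)) (hn : ‖R‖ ≤ 1) {v : E} (hv : ‖v‖ = 1) :
    2 * inner ℂ v (R v) ∈ ellipse δ := by
  set z := 2 * inner ℂ v (R v) with hz
  -- `(a, b)` is half the gradient at `z` of the quadratic form defining the ellipse, so that `m = a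
  -- z.re + b z.im`.
  set a := z.re / (1 + δ) ^ 2 with ha
  set b := z.im / (1 - δ) ^ 2 with hb
  have p1 : 0 < (1 + δ) ^ 2 := by positivity
  have p2 : 0 < (1 - δ) ^ 2 := by have := sub_pos.2 hδ₁; positivity
  set c : ℂ := ⟨a, b⟩ with hc
  set m := z.re ^ 2 / (1 + δ) ^ 2 + z.im ^ 2 / (1 - δ) ^ 2 with hm
  change m ≤ 1
  have hm0 : 0 ≤ m := by positivity
  set w := star c • R v + c • star R v with hw
  have hre : (inner ℂ v w).re = m := by
    have h1 : inner ℂ v (star R v) = star (inner ℂ v (R v)) := by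
      rw [star_eq_adjoint, adjoint_inner_right]
      exact (inner_conj_symm _ _).symm
    have h2 : (z.re = 2 * (inner ℂ v (R v)).re) ∧ z.im = 2 * (inner ℂ v (R v)).im := by
      simp [hz]
    rw [hw, inner_add_right, inner_smul_right, inner_smul_right, h1]
    simp only [Complex.star_def, Complex.add_re, Complex.mul_re, Complex.conj_re, Complex.conj_im,
      hc]
    have : m = a * z.re + b * z.im := by rw [hm, ha, hb]; ring
    rw [this, h2.1, h2.2]
    ring
  have hwn : ‖w‖ ^ 2 ≤ m := by
    have h1 : inner ℂ (R v) (star R v) = (δ : ℂ) := by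
      rw [star_eq_adjoint, adjoint_inner_right, ← mul_apply_eq_comp, hR]
      simp [inner_smul_left, inner_self_eq_norm_sq_to_K, hv, -Complex.coe_smul]
    have h2 : ‖w‖ ^ 2 = (a ^ 2 + b ^ 2) * (‖R v‖ ^ 2 + ‖star R v‖ ^ 2)
        + 2 * δ * (a ^ 2 - b ^ 2) := by
      have hcn : ‖c‖ ^ 2 = a ^ 2 + b ^ 2 := by
        rw [Complex.sq_norm, Complex.normSq_apply]; ring
      rw [hw, norm_add_sq (𝕜 := ℂ), inner_smul_left, inner_smul_right, h1, norm_smul, norm_smul,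
        norm_star, mul_pow, mul_pow, hcn]
      simp [hc]
      ring
    have h3 := norm_sq_add_norm_adjoint_sq_le hR hn v
    rw [hv] at h3
    have h4 : m = a ^ 2 * (1 + δ) ^ 2 + b ^ 2 * (1 - δ) ^ 2 := by
      rw [hm, ha, hb]; field_simp
    rw [h2, h4]
    nlinarith [mul_le_mul_of_nonneg_left h3 (by positivity : 0 ≤ a ^ 2 + b ^ 2)]
  have hle : m ≤ ‖w‖ := by
    rw [← hre]
    calc (inner ℂ v w).re ≤ ‖v‖ * ‖w‖ := re_inner_le_norm (𝕜 := ℂ) v w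
      _ = ‖w‖ := by rw [hv, one_mul]
  -- `m ≤ ‖w‖` and `‖w‖² ≤ m` give `m² ≤ m`.
  nlinarith [norm_nonneg w]

end QuadraticContraction

/-! ### Algebra of block operator matrices -/

section Block

variable {H : Type*} [NormedAddCommGroup H] [InnerProductSpace ℂ H]

theorem block_mul (A B C D A' B' C' D' : H →L[ℂ] H) :
    block A B C D * block A' B' C' D' =
      block (A * A' + B * C') (A * B' + B * D') (C * A' + D * C') (C * B' + D * D') := by
  ext v
  all_goals
    obtain ⟨x, y⟩ := v
    simp only [mul_apply_eq_comp, block_apply, add_apply, map_add]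
    congr 2 <;> abel

theorem smul_block (c : ℂ) (A B C D : H →L[ℂ] H) :
    c • block A B C D = block (c • A) (c • B) (c • C) (c • D) := by
  ext v
  all_goals
    obtain ⟨x, y⟩ := v
    simp only [smul_apply, block_apply, ← WithLp.toLp_smul, Prod.smul_mk, smul_add]

theorem block_one : block 1 0 0 1 = (1 : WithLp 2 (H × H) →L[ℂ] WithLp 2 (H × H)) := by
  ext v
  all_goals
    obtain ⟨x, y⟩ := v
    simp [block_apply]

theorem exists_eq_block (R : WithLp 2 (H × H) →L[ℂ] WithLp 2 (H × H)) :
    ∃ A B C D : H →L[ℂ] H, R = block A B C D := by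
  let e := WithLp.prodContinuousLinearEquiv 2 ℂ H H
  let M : H × H →L[ℂ] H × H := (e : WithLp 2 (H × H) →L[ℂ] H × H) ∘L R ∘L
    (e.symm : H × H →L[ℂ] WithLp 2 (H × H))
  refine ⟨fst ℂ H H ∘L M ∘L inl ℂ H H, fst ℂ H H ∘L M ∘L inr ℂ H H,
    snd ℂ H H ∘L M ∘L inl ℂ H H, snd ℂ H H ∘L M ∘L inr ℂ H H, ?_⟩
  ext v
  all_goals
    obtain ⟨x, y⟩ := v
    have : (WithLp.toLp 2 (x, y) : WithLp 2 (H × H)) =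
        WithLp.toLp 2 (x, 0) + WithLp.toLp 2 (0, y) := by
      rw [← WithLp.toLp_add]; simp
    rw [block_apply, this, map_add]
    rfl

theorem block_inj {A B C D A' B' C' D' : H →L[ℂ] H} (h : block A B C D = block A' B' C' D') :
    A = A' ∧ B = B' ∧ C = C' ∧ D = D' := by
  have h1 (x y : H) : A x + B y = A' x + B' y ∧ C x + D y = C' x + D' y := by
    have := congrArg (fun M : WithLp 2 (H × H) →L[ℂ] WithLp 2 (H × H) =>
      WithLp.ofLp (M (WithLp.toLp 2 (x, y)))) h
    simpa [block_apply] using this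
  refine ⟨?_, ?_, ?_, ?_⟩ <;> ext x
  · simpa using (h1 x 0).1
  · simpa using (h1 0 x).1
  · simpa using (h1 x 0).2
  · simpa using (h1 0 x).2

theorem norm_block_reflection_le :
    ‖(block 1 0 0 (-1) : WithLp 2 (H × H) →L[ℂ] WithLp 2 (H × H))‖ ≤ 1 := by
  refine opNorm_le_bound _ zero_le_one fun v => ?_
  obtain ⟨x, y⟩ := v
  rw [block_apply, WithLp.prod_norm_eq_of_L2, WithLp.prod_norm_eq_of_L2]
  simp

theorem isContractiveConj_iff_isContractiveBlock (T Q : H →L[ℂ] H) (S : (H →L[ℂ] H)ˣ) :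
    IsContractiveConj T Q S ↔ IsContractiveBlock T Q S := by
  have : (diagOne S : WithLp 2 (H × H) →L[ℂ] WithLp 2 (H × H)) * zOp T Q *
      ((diagOne S)⁻¹ : (WithLp 2 (H × H) →L[ℂ] WithLp 2 (H × H))ˣ) =
      (1 / 2 : ℂ) • block T (Q * ((S⁻¹ : (H →L[ℂ] H)ˣ) : H →L[ℂ] H))
        ((S : H →L[ℂ] H) * Q)
        ((S : H →L[ℂ] H) * T * ((S⁻¹ : (H →L[ℂ] H)ˣ) : H →L[ℂ] H)) := by
    change block 1 0 0 (S : H →L[ℂ] H) * zOp T Q *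
      block 1 0 0 ((S⁻¹ : (H →L[ℂ] H)ˣ) : H →L[ℂ] H) = _
    rw [zOp, smul_block, block_mul, block_mul, smul_block]
    simp
  rw [IsContractiveConj, IsContractiveBlock, this]

end Block

/-! ### Square roots of `T² - 4δ` -/

section RootChoice

variable {H : Type*} [NormedAddCommGroup H] [InnerProductSpace ℂ H]

theorem isUnit_of_isRootChoice {δ : ℝ} {T Q : H →L[ℂ] H} (hT : IsGeneric δ T)
    (hQ : IsRootChoice δ T Q) : IsUnit Q := by
  have h := spectrum.notMem_iff.1 hT.notMem_spectrum_sq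
  have h2 : IsUnit (Q ^ 2) := by
    rw [hQ.sq_eq, ← neg_sub, IsUnit.neg_iff]
    rwa [Algebra.algebraMap_eq_smul_one] at h
  exact (isUnit_pow_iff two_ne_zero).1 h2

/-- `Q` is a polynomial in `T`, interpolating a square root of `μ² - 4δ` at each eigenvalue `μ`. The
eigenvalues are distinct, so the characteristic polynomial divides `p² - (X² - 4δ)`, and
Cayley–Hamilton applies. -/
theorem exists_isRootChoice {δ : ℝ} {T : H →L[ℂ] H} (hT : IsGeneric δ T) :
    ∃ Q : H →L[ℂ] H, IsRootChoice δ T Q := by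
  have := hT.finiteDimensional
  let e := Module.End.toContinuousLinearMap (𝕜 := ℂ) H
  let f : Module.End ℂ H := e.symm T
  have hef : e f = T := e.apply_symm_apply T
  have hspec : spectrum ℂ f = spectrum ℂ T := AlgEquiv.spectrum_eq e.symm T
  have hmon : f.charpoly.Monic := LinearMap.charpoly_monic f
  have hset : (f.charpoly.roots.toFinset : Set ℂ) = spectrum ℂ T := by
    ext μ
    rw [← hspec, Module.End.mem_spectrum_iff_isRoot_charpoly]
    simp [mem_roots hmon.ne_zero]
  have hcard : f.charpoly.roots.toFinset.card = f.charpoly.roots.card := by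
    rw [← Set.ncard_coe_finset, hset, hT.card_spectrum, ← LinearMap.charpoly_natDegree f]
    exact ((IsAlgClosed.splits f.charpoly).natDegree_eq_card_roots)
  have hnodup := Multiset.toFinset_card_eq_card_iff_nodup.1 hcard
  choose g hg using fun z : ℂ => IsAlgClosed.exists_pow_nat_eq (z ^ 2 - 4 * (δ : ℂ)) two_pos
  let p : ℂ[X] := Lagrange.interpolate f.charpoly.roots.toFinset id g
  have hp : ∀ μ ∈ f.charpoly.roots, p.eval μ = g μ := fun μ hμ =>
    Lagrange.eval_interpolate_at_node g (Set.injOn_id _) (Multiset.mem_toFinset.2 hμ)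
  have hdvd : f.charpoly ∣ p ^ 2 - (X ^ 2 - C (4 * (δ : ℂ))) := by
    by_cases h0 : p ^ 2 - (X ^ 2 - C (4 * (δ : ℂ))) = 0
    · rw [h0]; exact dvd_zero _
    refine (IsAlgClosed.splits _).dvd_of_roots_le_roots hmon.ne_zero
      ((Multiset.le_iff_subset hnodup).2 fun μ hμ => ?_)
    rw [mem_roots h0, IsRoot.def]
    simp [hp μ hμ, hg]
  have haev : aeval f (p ^ 2 - (X ^ 2 - C (4 * (δ : ℂ)))) = 0 := by
    obtain ⟨q, hq⟩ := hdvd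
    rw [hq, map_mul, LinearMap.aeval_self_charpoly, zero_mul]
  have hT0 : aeval T (p ^ 2 - (X ^ 2 - C (4 * (δ : ℂ)))) = 0 := by
    rw [← hef, Polynomial.aeval_algHom_apply, haev, map_zero]
  refine ⟨aeval T p, ?_, ?_⟩
  · simpa using ((Commute.all p X).map (aeval T)).eq
  · rw [map_sub, map_sub, map_pow, map_pow, aeval_X, aeval_C, sub_eq_zero] at hT0
    rw [hT0, Algebra.algebraMap_eq_smul_one]

end RootChoice

/-! ### From the contractive block matrix to the numerical range -/

theorem numRange_subset_ellipse {H : Type*} [NormedAddCommGroup H] [InnerProductSpace ℂ H]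
    [CompleteSpace H] {δ : ℝ} (hδ₀ : 0 < δ) (hδ₁ : δ < 1) {T Q : H →L[ℂ] H}
    (hQ : IsRootChoice δ T Q) {S : (H →L[ℂ] H)ˣ} (hS : IsContractiveBlock T Q S) :
    numRange T ⊆ ellipse δ := by
  rintro z ⟨v, hv, rfl⟩
  have hQ2 : Q * Q = T * T - (4 * (δ : ℂ)) • (1 : H →L[ℂ] H) := by
    rw [← sq, ← sq, hQ.sq_eq]
  have hc (X : H →L[ℂ] H) : Q * (T * X) = T * (Q * X) := by
    rw [← mul_assoc, hQ.commute, mul_assoc]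
  have hq (X : H →L[ℂ] H) : Q * (Q * X) = T * (T * X) - (4 * (δ : ℂ)) • X := by
    rw [← mul_assoc, hQ2, sub_mul, mul_assoc, smul_mul_assoc, one_mul]
  -- The sign change in the second column makes the off-diagonal entries of `R * R` cancel and
  -- leaves `(T² - Q²)/4 = δ` in the corner.
  set R := ((1 / 2 : ℂ) • block T (Q * ((S⁻¹ : (H →L[ℂ] H)ˣ) : H →L[ℂ] H)) ((S : H →L[ℂ] H) * Q)
    ((S : H →L[ℂ] H) * T * ((S⁻¹ : (H →L[ℂ] H)ˣ) : H →L[ℂ] H))) * block 1 0 0 (-1) with hR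
  have hn : ‖R‖ ≤ 1 :=
    (norm_mul_le _ _).trans (mul_le_one₀ hS (norm_nonneg _) norm_block_reflection_le)
  have hRR : R * R = (δ : ℂ) • 1 := by
    rw [hR, ← block_one, smul_mul_assoc, block_mul, smul_mul_smul_comm, block_mul, smul_block,
      smul_block]
    congr 1 <;>
      simp [mul_assoc, hc, hQ2, hq, hQ.commute, mul_sub, smul_smul, -Complex.coe_smul] <;> ring_nf
  have hu : ‖(WithLp.toLp 2 (v, 0) : WithLp 2 (H × H))‖ = 1 := by
    rw [WithLp.prod_norm_eq_of_L2]; simp [hv]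
  have := two_smul_inner_mem_ellipse hδ₀ hδ₁ hRR hn hu
  rw [hR, smul_mul_assoc, block_mul, smul_block, block_apply, WithLp.prod_inner_apply] at this
  simpa [inner_smul_right] using this

end EllipticalRange

namespace EllipticalRange

open ContinuousLinearMap Filter Topology

/-! ### Positivity of tridiagonal Toeplitz forms -/

section Toeplitz

theorem sum_zpow_mul_of_isPrimitiveRoot {N : ℕ} {ζ : ℂ} (hζ : IsPrimitiveRoot ζ N)
    (m : ℤ) : ∑ j ∈ Finset.range N, ζ ^ (m * (j : ℤ)) = if (N : ℤ) ∣ m then (N : ℂ) else 0 := by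
  simp only [zpow_mul, zpow_natCast]
  split_ifs with h
  · rw [(hζ.zpow_eq_one_iff_dvd m).2 h]; simp
  · rw [geom_sum_eq (fun h' => h ((hζ.zpow_eq_one_iff_dvd m).1 h')), ← zpow_natCast, ← zpow_mul,
      (hζ.zpow_eq_one_iff_dvd _).2 (dvd_mul_left _ _), sub_self, zero_div]

variable {H : Type*} [NormedAddCommGroup H] [InnerProductSpace ℂ H]

/-- Orthogonality of characters: averaging over the `N`-th roots of unity isolates the `k`-th
diagonal, up to wrap-around modulo `N`. -/
theorem sum_zpow_mul_inner {N : ℕ} (hN : N ≠ 0) {ζ : ℂ} (hζ : IsPrimitiveRoot ζ N)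
    (M : H →L[ℂ] H) (x : ℕ → H) (n : ℕ) (k : ℤ) :
    ∑ j ∈ Finset.range N, ζ ^ (-k * (j : ℤ)) *
        inner ℂ (∑ a ∈ Finset.range n, ζ ^ ((a : ℤ) * (j : ℤ)) • x a)
          (M (∑ b ∈ Finset.range n, ζ ^ ((b : ℤ) * (j : ℤ)) • x b)) =
      N * ∑ a ∈ Finset.range n, ∑ b ∈ Finset.range n,
        if (N : ℤ) ∣ b - a - k then inner ℂ (x a) (M (x b)) else 0 := by
  have h0 : ζ ≠ 0 := hζ.ne_zero hN
  have hconj (m : ℤ) : (starRingEnd ℂ) (ζ ^ m) = ζ ^ (-m) := by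
    rw [map_zpow₀, ← Complex.inv_eq_conj (hζ.norm'_eq_one hN), inv_zpow, zpow_neg]
  simp only [map_sum, map_smul, sum_inner, inner_sum, inner_smul_left, inner_smul_right, hconj,
    Finset.mul_sum]
  rw [Finset.sum_comm]
  conv_rhs => rw [Finset.sum_comm]
  refine Finset.sum_congr rfl fun b _ => ?_
  rw [Finset.sum_comm]
  refine Finset.sum_congr rfl fun a _ => ?_
  have := sum_zpow_mul_of_isPrimitiveRoot hζ (b - a - k)
  have hexp : ∀ j : ℕ, ζ ^ (-k * (j : ℤ)) * (ζ ^ ((b : ℤ) * (j : ℤ)) * (ζ ^ (-((a : ℤ) * (j : ℤ))) *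
      inner ℂ (x a) (M (x b)))) = ζ ^ ((b - a - k : ℤ) * (j : ℤ)) * inner ℂ (x a) (M (x b)) := by
    intro j
    rw [← mul_assoc, ← mul_assoc, ← zpow_add₀ h0, ← zpow_add₀ h0]
    congr 2
    ring
  simp only [hexp]
  rw [← Finset.sum_mul, this]
  split_ifs <;> simp

/-- A block tridiagonal Toeplitz form with a nonnegative symbol is nonnegative. -/
theorem toeplitz_form_nonneg {V : H →L[ℂ] H} (hV : ∀ x, 2 * ‖inner ℂ x (V x)‖ ≤ ‖x‖ ^ 2)
    (x : ℕ → H) (n : ℕ) :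
    0 ≤ ∑ i ∈ Finset.range (n + 1), ‖x i‖ ^ 2 +
      2 * ∑ i ∈ Finset.range n, (inner ℂ (x i) (V (x (i + 1)))).re := by
  -- `b - a - 1` ranges over `[-(n + 1), n - 1]`, so `n + 2` is large enough to exclude wrap-around.
  set N := n + 2 with hN
  have hN0 : N ≠ 0 := by omega
  set ζ := Complex.exp (2 * Real.pi * Complex.I / N)
  have hζ : IsPrimitiveRoot ζ N := Complex.isPrimitiveRoot_exp N hN0
  set y : ℕ → H := fun j => ∑ a ∈ Finset.range (n + 1), ζ ^ ((a : ℤ) * (j : ℤ)) • x a with hy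
  have e0 := sum_zpow_mul_inner hN0 hζ 1 x (n + 1) 0
  have e1 := sum_zpow_mul_inner hN0 hζ V x (n + 1) 1
  have d0 : ∑ a ∈ Finset.range (n + 1), ∑ b ∈ Finset.range (n + 1),
      (if (N : ℤ) ∣ b - a - 0 then inner ℂ (x a) ((1 : H →L[ℂ] H) (x b)) else 0) =
      ∑ i ∈ Finset.range (n + 1), (‖x i‖ : ℂ) ^ 2 := by
    refine Finset.sum_congr rfl fun a ha => ?_
    rw [Finset.sum_eq_single_of_mem a ha]
    · simp
    · intro b hb hba
      rw [if_neg]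
      intro hd
      rw [Finset.mem_range] at ha hb
      have := Int.eq_zero_of_abs_lt_dvd hd (abs_lt.2 ⟨by omega, by omega⟩)
      omega
  have d1 : ∑ a ∈ Finset.range (n + 1), ∑ b ∈ Finset.range (n + 1),
      (if (N : ℤ) ∣ b - a - 1 then inner ℂ (x a) (V (x b)) else 0) =
      ∑ i ∈ Finset.range n, inner ℂ (x i) (V (x (i + 1))) := by
    have hz : ∀ a ∈ Finset.range (n + 1), ∀ b ∈ Finset.range (n + 1), b ≠ a + 1 →
        (if (N : ℤ) ∣ b - a - 1 then inner ℂ (x a) (V (x b)) else 0) = 0 := by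
      intro a ha b hb hba
      rw [if_neg]
      intro hd
      rw [Finset.mem_range] at ha hb
      have := Int.eq_zero_of_abs_lt_dvd hd (abs_lt.2 ⟨by omega, by omega⟩)
      omega
    rw [Finset.sum_range_succ, Finset.sum_eq_zero (s := Finset.range (n + 1)), add_zero]
    · refine Finset.sum_congr rfl fun a ha => ?_
      have ha' := Finset.mem_range.1 ha
      rw [Finset.sum_eq_single_of_mem (a + 1) (Finset.mem_range.2 (by omega))
        fun b hb hba => hz a (Finset.mem_range.2 (by omega)) b hb hba]
      simp
    · intro b hb
      have hb' := Finset.mem_range.1 hb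
      exact hz n (Finset.self_mem_range_succ n) b hb (by omega)
  rw [d0] at e0
  rw [d1] at e1
  -- The symbol `1 + 2 Re(ζ⁻ʲ V)` is nonnegative at each root of unity by the numerical radius
  -- bound.
  have hj (j : ℕ) : 0 ≤ (ζ ^ (-0 * (j : ℤ)) * inner ℂ (y j) ((1 : H →L[ℂ] H) (y j))).re +
      2 * (ζ ^ (-1 * (j : ℤ)) * inner ℂ (y j) (V (y j))).re := by
    have h1 : (ζ ^ (-0 * (j : ℤ)) * inner ℂ (y j) ((1 : H →L[ℂ] H) (y j))).re = ‖y j‖ ^ 2 := by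
      have : inner ℂ (y j) (y j) = ((‖y j‖ ^ 2 : ℝ) : ℂ) := by
        rw [inner_self_eq_norm_sq_to_K]; simp
      simp only [neg_zero, zero_mul, zpow_zero, one_mul, one_apply_eq_self, this, Complex.ofReal_re]
    have h2 : ‖ζ ^ (-1 * (j : ℤ)) * inner ℂ (y j) (V (y j))‖ = ‖inner ℂ (y j) (V (y j))‖ := by
      rw [norm_mul, norm_zpow, hζ.norm'_eq_one hN0, one_zpow, one_mul]
    have h3 := Complex.abs_re_le_norm (ζ ^ (-1 * (j : ℤ)) * inner ℂ (y j) (V (y j)))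
    rw [h2] at h3
    have h4 := (abs_le.1 h3).1
    have h5 := hV (y j)
    rw [h1]
    linarith
  have hsum := Finset.sum_nonneg fun j (_ : j ∈ Finset.range N) => hj j
  rw [Finset.sum_add_distrib, ← Finset.mul_sum, ← Complex.re_sum, ← Complex.re_sum, e0, e1] at hsum
  have hNpos : (0 : ℝ) < N := by positivity
  have r0 : ((N : ℂ) * ∑ i ∈ Finset.range (n + 1), (‖x i‖ : ℂ) ^ 2).re =
      N * ∑ i ∈ Finset.range (n + 1), ‖x i‖ ^ 2 := by
    rw [← Complex.ofReal_re (N * ∑ i ∈ Finset.range (n + 1), ‖x i‖ ^ 2)]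
    push_cast
    rfl
  have r1 : ((N : ℂ) * ∑ i ∈ Finset.range n, inner ℂ (x i) (V (x (i + 1)))).re =
      N * ∑ i ∈ Finset.range n, (inner ℂ (x i) (V (x (i + 1)))).re := by
    rw [← Complex.ofReal_natCast, Complex.re_ofReal_mul, Complex.re_sum]
  rw [r0, r1] at hsum
  refine nonneg_of_mul_nonneg_right (a := (N : ℝ)) ?_ hNpos
  linarith

end Toeplitz

end EllipticalRange

namespace EllipticalRange

open ContinuousLinearMap Filter Topology

/-! ### Schur complements and approximate factorization -/

section FejerRiesz

variable {H : Type*} [NormedAddCommGroup H] [InnerProductSpace ℂ H]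

theorem re_inner_real_smul_one (c : ℝ) (x : H) :
    (inner ℂ x (((c : ℂ) • (1 : H →L[ℂ] H)) x)).re = c * ‖x‖ ^ 2 := by
  have : inner ℂ x x = ((‖x‖ ^ 2 : ℝ) : ℂ) := by
    rw [inner_self_eq_norm_sq_to_K]; simp
  rw [smul_apply, one_apply_eq_self, inner_smul_right, this, ← Complex.ofReal_mul,
    Complex.ofReal_re]

variable [CompleteSpace H]

theorem le_of_isSelfAdjoint_of_forall_re_inner_le {A B : H →L[ℂ] H} (hA : IsSelfAdjoint A)
    (hB : IsSelfAdjoint B) (h : ∀ x, (inner ℂ x (A x)).re ≤ (inner ℂ x (B x)).re) : A ≤ B := by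
  rw [ContinuousLinearMap.le_def]
  refine ⟨((isSelfAdjoint_iff_isSymmetric).1 (hB.sub hA)), fun x => ?_⟩
  change 0 ≤ RCLike.re (inner ℂ ((B - A) x) x)
  rw [inner_re_symm, sub_apply, inner_sub_right, map_sub]
  exact sub_nonneg.2 (h x)

/-- The iterated Schur complements of the block tridiagonal Toeplitz operators with symbol
`c + z V + (z V)*`. -/
noncomputable def schurSeq (c : ℝ) (V : H →L[ℂ] H) : ℕ → (H →L[ℂ] H)
  | 0 => (c : ℂ) • 1
  | k + 1 => (c : ℂ) • 1 - star V * Ring.inverse (schurSeq c V k) * V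

theorem isSelfAdjoint_real_smul_one (c : ℝ) : IsSelfAdjoint ((c : ℂ) • (1 : H →L[ℂ] H)) := by
  rw [isSelfAdjoint_iff, star_smul, star_one]
  simp

theorem isSelfAdjoint_schurSeq (c : ℝ) (V : H →L[ℂ] H) (k : ℕ) :
    IsSelfAdjoint (schurSeq c V k) := by
  induction k with
  | zero => exact isSelfAdjoint_real_smul_one c
  | succ k ih =>
    refine (isSelfAdjoint_real_smul_one c).sub ?_
    have h : IsSelfAdjoint (Ring.inverse (schurSeq c V k)) := by
      rw [isSelfAdjoint_iff, ← Ring.inverse_star, ih.star_eq]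
    exact h.conjugate' V

theorem real_smul_one_nonneg {c : ℝ} (hc : 0 ≤ c) : (0 : H →L[ℂ] H) ≤ (c : ℂ) • 1 := by
  refine le_of_isSelfAdjoint_of_forall_re_inner_le (IsSelfAdjoint.zero _)
    (isSelfAdjoint_real_smul_one c) fun x => ?_
  rw [re_inner_real_smul_one]
  simp only [zero_apply, inner_zero_right, Complex.zero_re]
  positivity

theorem isUnit_of_real_smul_one_le {ε : ℝ} (hε : 0 < ε) {A : H →L[ℂ] H}
    (h : (ε : ℂ) • (1 : H →L[ℂ] H) ≤ A) : IsUnit A := by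
  refine CStarAlgebra.isUnit_of_le _ h ?_
  rw [IsStrictlyPositive.iff_of_unital]
  exact ⟨real_smul_one_nonneg hε.le,
    isUnit_one.smul (Units.mk0 (ε : ℂ) (by exact_mod_cast hε.ne'))⟩

/-- The Schur complement at `x` is a value of the Toeplitz form on a sequence ending in `x`.
Toeplitz positivity leaves the surplus `ε`, hence the lower bound; this makes the complement
invertible and lets the recursion continue. -/
theorem exists_schurSeq_form_eq {ε : ℝ} (hε : 0 < ε) {V : H →L[ℂ] H}
    (hV : ∀ x, 2 * ‖inner ℂ x (V x)‖ ≤ ‖x‖ ^ 2) (k : ℕ) :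
    (∀ x, ∃ s : ℕ → H, s k = x ∧ (inner ℂ x (schurSeq (1 + ε) V k x)).re =
      (1 + ε) * ∑ i ∈ Finset.range (k + 1), ‖s i‖ ^ 2 +
        2 * ∑ i ∈ Finset.range k, (inner ℂ (s i) (V (s (i + 1)))).re) ∧
    (ε : ℂ) • 1 ≤ schurSeq (1 + ε) V k := by
  have key : ∀ k, (∀ x, ∃ s : ℕ → H, s k = x ∧ (inner ℂ x (schurSeq (1 + ε) V k x)).re =
      (1 + ε) * ∑ i ∈ Finset.range (k + 1), ‖s i‖ ^ 2 +
        2 * ∑ i ∈ Finset.range k, (inner ℂ (s i) (V (s (i + 1)))).re) →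
      (ε : ℂ) • 1 ≤ schurSeq (1 + ε) V k := by
    intro k h
    refine le_of_isSelfAdjoint_of_forall_re_inner_le (isSelfAdjoint_real_smul_one ε)
      (isSelfAdjoint_schurSeq _ _ _) fun x => ?_
    obtain ⟨s, hs, he⟩ := h x
    rw [re_inner_real_smul_one, he]
    have h1 := toeplitz_form_nonneg hV s k
    have h2 : ‖x‖ ^ 2 ≤ ∑ i ∈ Finset.range (k + 1), ‖s i‖ ^ 2 := by
      rw [← hs]
      exact Finset.single_le_sum (f := fun i => ‖s i‖ ^ 2) (fun i _ => by positivity)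
        (Finset.self_mem_range_succ k)
    nlinarith
  suffices h : ∀ x, ∃ s : ℕ → H, s k = x ∧ (inner ℂ x (schurSeq (1 + ε) V k x)).re =
      (1 + ε) * ∑ i ∈ Finset.range (k + 1), ‖s i‖ ^ 2 +
        2 * ∑ i ∈ Finset.range k, (inner ℂ (s i) (V (s (i + 1)))).re from ⟨h, key k h⟩
  induction k with
  | zero =>
    intro x
    refine ⟨fun _ => x, rfl, ?_⟩
    rw [schurSeq, re_inner_real_smul_one]
    simp
  | succ k ih =>
    intro x
    have hu : IsUnit (schurSeq (1 + ε) V k) := isUnit_of_real_smul_one_le hε (key k ih)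
    set A := schurSeq (1 + ε) V k with hA
    set u := Ring.inverse A (V x) with hu_def
    have hAu : A u = V x := by
      rw [hu_def, ← mul_apply_eq_comp, Ring.mul_inverse_cancel _ hu, one_apply_eq_self]
    -- Completing the square: `-A⁻¹Vx` minimizes `⟨y, Ay⟩ + 2 Re⟨y, Vx⟩` over `y`.
    obtain ⟨s, hs, he⟩ := ih (-u)
    refine ⟨Function.update s (k + 1) x, by simp, ?_⟩
    have hlt : ∀ i, i < k + 1 → Function.update s (k + 1) x i = s i := fun i hi =>
      Function.update_of_ne (by omega) _ _
    have s1 : ∑ i ∈ Finset.range (k + 1), ‖Function.update s (k + 1) x i‖ ^ 2 =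
        ∑ i ∈ Finset.range (k + 1), ‖s i‖ ^ 2 :=
      Finset.sum_congr rfl fun i hi => by rw [hlt i (Finset.mem_range.1 hi)]
    have s2 : ∑ i ∈ Finset.range k, (inner ℂ (Function.update s (k + 1) x i)
        (V (Function.update s (k + 1) x (i + 1)))).re =
        ∑ i ∈ Finset.range k, (inner ℂ (s i) (V (s (i + 1)))).re :=
      Finset.sum_congr rfl fun i hi => by
        have := Finset.mem_range.1 hi
        rw [hlt i (by omega), hlt (i + 1) (by omega)]
    rw [Finset.sum_range_succ _ (k + 1), s1, Finset.sum_range_succ (fun i =>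
        (inner ℂ (Function.update s (k + 1) x i) (V (Function.update s (k + 1) x (i + 1)))).re) k, s2,
      hlt k (by omega), Function.update_self, hs]
    have hneg : (inner ℂ (-u) (A (-u))).re = (inner ℂ u (V x)).re := by
      rw [map_neg, inner_neg_neg, hAu]
    have hx : (inner ℂ x (schurSeq (1 + ε) V (k + 1) x)).re =
        (1 + ε) * ‖x‖ ^ 2 - (inner ℂ u (V x)).re := by
      rw [schurSeq, sub_apply, inner_sub_right, Complex.sub_re, re_inner_real_smul_one,
        mul_apply_eq_comp, mul_apply_eq_comp, ← hA, ← hu_def, star_eq_adjoint, adjoint_inner_right]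
      congr 1
      exact inner_re_symm (𝕜 := ℂ) _ _
    rw [hneg] at he
    rw [hx, inner_neg_left, Complex.neg_re]
    linarith

theorem schurSeq_nonneg {ε : ℝ} (hε : 0 < ε) {V : H →L[ℂ] H}
    (hV : ∀ x, 2 * ‖inner ℂ x (V x)‖ ≤ ‖x‖ ^ 2) (k : ℕ) :
    (0 : H →L[ℂ] H) ≤ schurSeq (1 + ε) V k :=
  (real_smul_one_nonneg hε.le).trans (exists_schurSeq_form_eq hε hV k).2

/-- Inversion reverses order on positive invertibles, so a decrease at one stage propagates to the
next. -/
theorem schurSeq_succ_le {ε : ℝ} (hε : 0 < ε) {V : H →L[ℂ] H}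
    (hV : ∀ x, 2 * ‖inner ℂ x (V x)‖ ≤ ‖x‖ ^ 2) (k : ℕ) :
    schurSeq (1 + ε) V (k + 1) ≤ schurSeq (1 + ε) V k := by
  have hunit (k : ℕ) : IsUnit (schurSeq (1 + ε) V k) :=
    isUnit_of_real_smul_one_le hε (exists_schurSeq_form_eq hε hV k).2
  induction k with
  | zero =>
    change schurSeq (1 + ε) V 0 - star V * Ring.inverse (schurSeq (1 + ε) V 0) * V ≤ _
    refine (sub_le_self_iff _).2 (star_left_conjugate_nonneg ?_ V)
    have h0 := schurSeq_nonneg hε hV 0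
    obtain ⟨u, hu⟩ := hunit 0
    rw [← hu] at h0 ⊢
    rw [Ring.inverse_unit]
    exact CFC.inv_nonneg_of_nonneg u h0
  | succ k ih =>
    change _ - star V * Ring.inverse (schurSeq (1 + ε) V (k + 1)) * V ≤
      _ - star V * Ring.inverse (schurSeq (1 + ε) V k) * V
    refine sub_le_sub_left (star_left_conjugate_le_conjugate ?_ V) _
    have h0 := schurSeq_nonneg hε hV (k + 1)
    obtain ⟨u, hu⟩ := hunit (k + 1)
    obtain ⟨w, hw⟩ := hunit k
    rw [← hu, ← hw] at ih
    rw [← hu] at h0 ⊢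
    rw [← hw, Ring.inverse_unit, Ring.inverse_unit]
    exact CStarAlgebra.inv_le_inv h0 ih

/-- Two operators factoring `V`, with the squared norms controlled by consecutive Schur
complements. -/
theorem exists_factor_schurSeq {ε : ℝ} (hε : 0 < ε) {V : H →L[ℂ] H}
    (hV : ∀ x, 2 * ‖inner ℂ x (V x)‖ ≤ ‖x‖ ^ 2) (k : ℕ) :
    ∃ F G : H →L[ℂ] H, star F * G = V ∧
      (∀ x, ‖F x‖ ^ 2 = (inner ℂ x (schurSeq (1 + ε) V k x)).re) ∧
      ∀ x, ‖G x‖ ^ 2 = (1 + ε) * ‖x‖ ^ 2 - (inner ℂ x (schurSeq (1 + ε) V (k + 1) x)).re := by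
  have hu := isUnit_of_real_smul_one_le hε (exists_schurSeq_form_eq hε hV k).2
  have hpos := schurSeq_nonneg hε hV k
  set A := schurSeq (1 + ε) V k with hA
  obtain ⟨F, hF⟩ := CStarAlgebra.nonneg_iff_eq_star_mul_self.1 hpos
  have hsq (F : H →L[ℂ] H) (x : H) : ‖F x‖ ^ 2 = (inner ℂ x ((star F * F) x)).re := by
    rw [mul_apply_eq_comp, star_eq_adjoint, adjoint_inner_right]
    exact (inner_self_eq_norm_sq (𝕜 := ℂ) (F x)).symm
  have hFG : star F * (F * (Ring.inverse A * V)) = V := by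
    rw [← mul_assoc, ← hF, ← mul_assoc, Ring.mul_inverse_cancel _ hu, one_mul]
  refine ⟨F, F * (Ring.inverse A * V), hFG, fun x => by rw [hsq, ← hF], fun x => ?_⟩
  have hinv : star (Ring.inverse A) = Ring.inverse A := by
    rw [← Ring.inverse_star, (isSelfAdjoint_schurSeq (1 + ε) V k).star_eq]
  have hG : star (F * (Ring.inverse A * V)) * (F * (Ring.inverse A * V)) =
      star V * Ring.inverse A * V := by
    rw [star_mul, mul_assoc, hFG, star_mul, hinv]
  rw [hsq, hG, schurSeq, ← hA, sub_apply, inner_sub_right, Complex.sub_re, re_inner_real_smul_one]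
  ring

end FejerRiesz

/-! ### Passage to the limit in finite dimension -/

section Compactness

variable {H : Type*} [NormedAddCommGroup H] [InnerProductSpace ℂ H]

theorem norm_le_of_norm_sq_add_le {F G : H →L[ℂ] H} {c : ℝ} (hc : 0 ≤ c)
    (h : ∀ x, ‖F x‖ ^ 2 + ‖G x‖ ^ 2 ≤ c * ‖x‖ ^ 2) : ‖F‖ ≤ √c ∧ ‖G‖ ≤ √c := by
  constructor <;> refine opNorm_le_bound _ (Real.sqrt_nonneg c) fun x => ?_ <;>
    refine le_of_sq_le_sq ?_ (by positivity) <;> rw [mul_pow, Real.sq_sqrt hc] <;>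
    nlinarith [h x, sq_nonneg ‖F x‖, sq_nonneg ‖G x‖]

variable [FiniteDimensional ℂ H]

theorem exists_factor_of_tendsto [CompleteSpace H] {V : H →L[ℂ] H} {F G : ℕ → H →L[ℂ] H} {C c : ℝ}
    (hFC : ∀ k, ‖F k‖ ≤ C) (hGC : ∀ k, ‖G k‖ ≤ C) (hFG : ∀ k, star (F k) * G k = V)
    (hlim : ∀ x, Tendsto (fun k => ‖F k x‖ ^ 2 + ‖G k x‖ ^ 2) atTop (𝓝 (c * ‖x‖ ^ 2))) :
    ∃ F G : H →L[ℂ] H, star F * G = V ∧ ∀ x, ‖F x‖ ^ 2 + ‖G x‖ ^ 2 = c * ‖x‖ ^ 2 := by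
  have : ProperSpace (H →L[ℂ] H) := FiniteDimensional.proper ℂ _
  obtain ⟨P, -, φ, hφ, hP⟩ := tendsto_subseq_of_bounded
    (Metric.isBounded_closedBall (x := (0 : (H →L[ℂ] H) × (H →L[ℂ] H))) (r := C))
    (x := fun k => (F k, G k)) fun k => by
      rw [mem_closedBall_zero_iff]; exact max_le (hFC k) (hGC k)
  have hF : Tendsto (fun k => F (φ k)) atTop (𝓝 P.1) := (continuous_fst.tendsto P).comp hP
  have hG : Tendsto (fun k => G (φ k)) atTop (𝓝 P.2) := (continuous_snd.tendsto P).comp hP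
  refine ⟨P.1, P.2, ?_, fun x => ?_⟩
  · refine tendsto_nhds_unique ((hF.star).mul hG) ?_
    simp only [hFG]
    exact tendsto_const_nhds
  · have e (X : H →L[ℂ] H) : Tendsto (fun Y : H →L[ℂ] H => Y x) (𝓝 X) (𝓝 (X x)) :=
      (ContinuousLinearMap.apply ℂ H x).continuous.tendsto X
    refine tendsto_nhds_unique ((((e _).comp hF).norm.pow 2).add (((e _).comp hG).norm.pow 2)) ?_
    exact (hlim x).comp hφ.tendsto_atTop

/-- A strict form of the operator Fejér–Riesz factorization in degree one. -/
theorem exists_factor_of_pos [CompleteSpace H] {ε : ℝ} (hε : 0 < ε) {V : H →L[ℂ] H}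
    (hV : ∀ x, 2 * ‖inner ℂ x (V x)‖ ≤ ‖x‖ ^ 2) :
    ∃ F G : H →L[ℂ] H, star F * G = V ∧ ∀ x, ‖F x‖ ^ 2 + ‖G x‖ ^ 2 = (1 + ε) * ‖x‖ ^ 2 := by
  choose F G hFG hF hG using exists_factor_schurSeq hε hV
  have hanti (x : H) : Antitone fun k => ‖F k x‖ ^ 2 := by
    refine antitone_nat_of_succ_le fun k => ?_
    rw [hF, hF]
    have h := (schurSeq_succ_le hε hV k)
    rw [ContinuousLinearMap.le_def] at h
    have := h.re_inner_nonneg_right x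
    rw [sub_apply, inner_sub_right, map_sub, sub_nonneg] at this
    exact this
  have hGF (k : ℕ) (x : H) : ‖G k x‖ ^ 2 = (1 + ε) * ‖x‖ ^ 2 - ‖F (k + 1) x‖ ^ 2 := by
    rw [hG, hF]
  have hF0 (k : ℕ) (x : H) : ‖F k x‖ ^ 2 ≤ (1 + ε) * ‖x‖ ^ 2 := by
    refine (hanti x (Nat.zero_le k)).trans ?_
    simp only [hF]
    rw [schurSeq, re_inner_real_smul_one]
  have hbound (k : ℕ) : ‖F k‖ ≤ √(2 * (1 + ε)) ∧ ‖G k‖ ≤ √(2 * (1 + ε)) := by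
    refine norm_le_of_norm_sq_add_le (by positivity) fun x => ?_
    have := hF0 k x
    rw [hGF]
    nlinarith [sq_nonneg ‖F (k + 1) x‖]
  refine exists_factor_of_tendsto (fun k => (hbound k).1) (fun k => (hbound k).2) hFG fun x => ?_
  have hl := tendsto_atTop_ciInf (hanti x) ⟨0, by rintro _ ⟨k, rfl⟩; positivity⟩
  -- `‖F k x‖² + ‖G k x‖²` differs from `(1 + ε)‖x‖²` by the difference of consecutive terms of a
  -- convergent sequence.
  have hl' := (hl.sub (hl.comp (tendsto_add_atTop_nat 1))).add_const ((1 + ε) * ‖x‖ ^ 2)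
  rw [sub_self, zero_add] at hl'
  refine hl'.congr fun k => ?_
  rw [hGF]
  simp only [Function.comp_apply]
  ring

/-- The operator Fejér–Riesz factorization in degree one: an operator of numerical radius at most
`1/2` is a compression of `[[0, 1], [0, 0]]`. -/
theorem exists_factor_of_numerical_radius_le [CompleteSpace H] {V : H →L[ℂ] H}
    (hV : ∀ x, 2 * ‖inner ℂ x (V x)‖ ≤ ‖x‖ ^ 2) :
    ∃ F G : H →L[ℂ] H, star F * G = V ∧ ∀ x, ‖F x‖ ^ 2 + ‖G x‖ ^ 2 = ‖x‖ ^ 2 := by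
  choose F G hFG hsum using fun n : ℕ =>
    exists_factor_of_pos (Nat.one_div_pos_of_nat (α := ℝ) (n := n)) hV
  have hbound (k : ℕ) : ‖F k‖ ≤ √2 ∧ ‖G k‖ ≤ √2 := by
    refine norm_le_of_norm_sq_add_le (by positivity) fun x => ?_
    rw [hsum]
    have : 1 / ((k : ℝ) + 1) ≤ 1 := by
      rw [div_le_one (by positivity)]; linarith [(Nat.cast_nonneg k : (0 : ℝ) ≤ k)]
    nlinarith [sq_nonneg ‖x‖]
  have := exists_factor_of_tendsto (c := 1) (fun k => (hbound k).1) (fun k => (hbound k).2) hFG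
    fun x => by
      simp only [hsum]
      have := (tendsto_one_div_add_atTop_nhds_zero_nat (𝕜 := ℝ)).const_add 1
      rw [add_zero] at this
      exact this.mul_const _
  simpa using this

end Compactness

end EllipticalRange

namespace EllipticalRange

open ContinuousLinearMap

/-! ### Dilation to a contraction with square `δ` -/

section Dilation

variable {H : Type*} [NormedAddCommGroup H] [InnerProductSpace ℂ H]

theorem norm_sub_smul_conj_le {δ : ℝ} (hδ₀ : 0 < δ) (hδ₁ : δ < 1) {z : ℂ} (hz : z ∈ ellipse δ) :
    ‖z - δ * (starRingEnd ℂ) z‖ ≤ 1 - δ ^ 2 := by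
  have h1 : 0 < 1 - δ := sub_pos.2 hδ₁
  have h2 : 0 < 1 + δ := by positivity
  change z.re ^ 2 / (1 + δ) ^ 2 + z.im ^ 2 / (1 - δ) ^ 2 ≤ 1 at hz
  have h3 : ‖z - δ * (starRingEnd ℂ) z‖ ^ 2 = (z.re ^ 2 / (1 + δ) ^ 2 + z.im ^ 2 / (1 - δ) ^ 2) *
      (1 - δ ^ 2) ^ 2 := by
    rw [Complex.sq_norm, Complex.normSq_apply]
    simp only [Complex.sub_re, Complex.sub_im, Complex.mul_re, Complex.mul_im, Complex.conj_re,
      Complex.conj_im, Complex.ofReal_re, Complex.ofReal_im]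
    field_simp
    ring
  have h4 : 0 ≤ 1 - δ ^ 2 := by nlinarith
  refine le_of_sq_le_sq ?_ h4
  rw [h3]
  exact mul_le_of_le_one_left (sq_nonneg _) hz

theorem exists_factor_of_numRange_subset [FiniteDimensional ℂ H] [CompleteSpace H] {δ : ℝ}
    (hδ₀ : 0 < δ) (hδ₁ : δ < 1) {T : H →L[ℂ] H} (hT : numRange T ⊆ ellipse δ) :
    ∃ F G : H →L[ℂ] H, star F * G + (δ : ℂ) • (star G * F) = (1 / 2 : ℂ) • T ∧
      ∀ x, ‖F x‖ ^ 2 + ‖G x‖ ^ 2 = ‖x‖ ^ 2 := by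
  have hδ2 : 0 < 1 - δ ^ 2 := by nlinarith
  have hδ3 : (1 - (δ : ℂ) ^ 2) ≠ 0 := by exact_mod_cast hδ2.ne'
  have hx (x : H) : ‖inner ℂ x (T x) - δ * (starRingEnd ℂ) (inner ℂ x (T x))‖ ≤
      (1 - δ ^ 2) * ‖x‖ ^ 2 := by
    rcases eq_or_ne x 0 with rfl | h0
    · simp
    have hn : (‖x‖ : ℂ) ≠ 0 := by exact_mod_cast norm_ne_zero_iff.2 h0
    have hv : ‖((‖x‖ : ℂ)⁻¹ • x)‖ = 1 := by
      rw [norm_smul, norm_inv, Complex.norm_real, norm_norm, inv_mul_cancel₀ (norm_ne_zero_iff.2 h0)]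
    have h1 := norm_sub_smul_conj_le hδ₀ hδ₁ (hT ⟨_, hv, rfl⟩)
    have h2 : inner ℂ x (T x) = (‖x‖ : ℂ) ^ 2 *
        inner ℂ ((‖x‖ : ℂ)⁻¹ • x) (T ((‖x‖ : ℂ)⁻¹ • x)) := by
      rw [map_smul, inner_smul_left, inner_smul_right, map_inv₀, Complex.conj_ofReal]
      field_simp
    have h3 : ‖((‖x‖ : ℂ) ^ 2)‖ = ‖x‖ ^ 2 := by rw [norm_pow, Complex.norm_real, norm_norm]
    rw [h2, map_mul, map_pow, Complex.conj_ofReal, mul_left_comm, ← mul_sub, norm_mul, h3, mul_comm]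
    exact mul_le_mul_of_nonneg_right h1 (sq_nonneg _)
  obtain ⟨F, G, hFG, hsum⟩ := exists_factor_of_numerical_radius_le
    (V := (1 / (2 * (1 - (δ : ℂ) ^ 2))) • (T - (δ : ℂ) • star T)) fun x => by
      have e : inner ℂ x (((1 / (2 * (1 - (δ : ℂ) ^ 2))) • (T - (δ : ℂ) • star T)) x) =
          1 / (2 * (1 - (δ : ℂ) ^ 2)) *
            (inner ℂ x (T x) - δ * (starRingEnd ℂ) (inner ℂ x (T x))) := by
        rw [smul_apply, sub_apply, smul_apply, inner_smul_right, inner_sub_right, inner_smul_right,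
          star_eq_adjoint, adjoint_inner_right, inner_conj_symm]
      have e2 : ‖1 / (2 * (1 - (δ : ℂ) ^ 2))‖ = 1 / (2 * (1 - δ ^ 2)) := by
        rw [show 1 / (2 * (1 - (δ : ℂ) ^ 2)) = ((1 / (2 * (1 - δ ^ 2)) : ℝ) : ℂ) by push_cast; rfl,
          Complex.norm_real, Real.norm_of_nonneg (by positivity)]
      rw [e, norm_mul, e2]
      calc 2 * (1 / (2 * (1 - δ ^ 2)) * _) ≤
          2 * (1 / (2 * (1 - δ ^ 2)) * ((1 - δ ^ 2) * ‖x‖ ^ 2)) := by gcongr; exact hx x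
        _ = ‖x‖ ^ 2 := by field_simp
  refine ⟨F, G, ?_, hsum⟩
  -- With `V = F*G`, the combination `V + δV*` cancels the `T*` terms and leaves `(1 - δ²)T/(2(1 -
  -- δ²)) = T/2`.
  have hGF : star G * F = star ((1 / (2 * (1 - (δ : ℂ) ^ 2))) • (T - (δ : ℂ) • star T)) := by
    rw [← hFG, star_mul, star_star]
  have hc : star (1 / (2 * (1 - (δ : ℂ) ^ 2))) = 1 / (2 * (1 - (δ : ℂ) ^ 2)) := by
    simp
  rw [hFG, hGF, star_smul, hc, star_sub, star_smul, star_star]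
  ext x
  simp only [add_apply, smul_apply, sub_apply, Complex.star_def, Complex.conj_ofReal]
  match_scalars
  · field_simp
    ring
  · field_simp
    ring

/-- Half of an operator with numerical range in the ellipse is a compression of a contraction
whose square is `δ`. -/
theorem exists_contraction_sq_eq [FiniteDimensional ℂ H] [CompleteSpace H] {δ : ℝ}
    (hδ₀ : 0 < δ) (hδ₁ : δ < 1) {T : H →L[ℂ] H} (hT : numRange T ⊆ ellipse δ) :
    ∃ B C D : H →L[ℂ] H, ‖block ((1 / 2 : ℂ) • T) B C D‖ ≤ 1 ∧
      block ((1 / 2 : ℂ) • T) B C D * block ((1 / 2 : ℂ) • T) B C D =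
        block ((δ : ℂ) • 1) 0 0 ((δ : ℂ) • 1) := by
  obtain ⟨F, G, hFG, hsum⟩ := exists_factor_of_numRange_subset hδ₀ hδ₁ hT
  let p : Submodule ℂ (WithLp 2 (H × H)) :=
    LinearMap.ker ((snd ℂ H H ∘L (WithLp.prodContinuousLinearEquiv 2 ℂ H H :
      WithLp 2 (H × H) →L[ℂ] H × H)) : WithLp 2 (H × H) →ₗ[ℂ] H)
  have hp (v : p) : (v : WithLp 2 (H × H)).snd = 0 := LinearMap.mem_ker.1 v.2
  let L : p →ₗᵢ[ℂ] WithLp 2 (H × H) :=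
    { toLinearMap := (block F 0 G 0 : WithLp 2 (H × H) →ₗ[ℂ] WithLp 2 (H × H)) ∘ₗ p.subtype
      norm_map' := fun v => by
        change ‖block F 0 G 0 (v : WithLp 2 (H × H))‖ = ‖(v : WithLp 2 (H × H))‖
        have h := hp v
        obtain ⟨⟨x, y⟩, hv⟩ := v
        change y = 0 at h
        rw [block_apply, WithLp.prod_norm_eq_of_L2, WithLp.prod_norm_eq_of_L2]
        simp [h, hsum] }
  -- In finite dimension the isometry on `H ⊕ 0` extends to a unitary of `H ⊕ H`, so no larger space
  -- is needed.
  let W : WithLp 2 (H × H) ≃ₗᵢ[ℂ] WithLp 2 (H × H) := L.extend.toLinearIsometryEquiv rfl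
  have hW (x : H) : W (WithLp.toLp 2 (x, 0)) = WithLp.toLp 2 (F x, G x) := by
    have hx : (WithLp.toLp 2 (x, 0) : WithLp 2 (H × H)) ∈ p := LinearMap.mem_ker.2 rfl
    have h1 : W (WithLp.toLp 2 (x, 0)) = L ⟨_, hx⟩ := L.extend_apply ⟨_, hx⟩
    rw [h1]
    change block F 0 G 0 (WithLp.toLp 2 (x, 0)) = _
    rw [block_apply]
    simp
  let R₀ : WithLp 2 (H × H) →L[ℂ] WithLp 2 (H × H) := block 0 1 ((δ : ℂ) • 1) 0
  have hR₀ (x y : H) : R₀ (WithLp.toLp 2 (x, y)) = WithLp.toLp 2 (y, (δ : ℂ) • x) := by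
    change block 0 1 ((δ : ℂ) • 1) 0 (WithLp.toLp 2 (x, y)) = _
    rw [block_apply]
    simp
  have hR₀n (v : WithLp 2 (H × H)) : ‖R₀ v‖ ≤ ‖v‖ := by
    obtain ⟨x, y⟩ := v
    rw [hR₀, WithLp.prod_norm_eq_of_L2, WithLp.prod_norm_eq_of_L2]
    refine Real.sqrt_le_sqrt ?_
    change ‖y‖ ^ 2 + ‖(δ : ℂ) • x‖ ^ 2 ≤ ‖x‖ ^ 2 + ‖y‖ ^ 2
    rw [norm_smul, Complex.norm_real, Real.norm_eq_abs, mul_pow, sq_abs]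
    have : δ ^ 2 ≤ 1 := by nlinarith
    nlinarith [sq_nonneg ‖x‖]
  have hR₀sq (v : WithLp 2 (H × H)) : R₀ (R₀ v) = (δ : ℂ) • v := by
    obtain ⟨x, y⟩ := v
    rw [hR₀, hR₀, ← WithLp.toLp_smul]
    rfl
  let R : WithLp 2 (H × H) →L[ℂ] WithLp 2 (H × H) :=
    (W.symm : WithLp 2 (H × H) →L[ℂ] WithLp 2 (H × H)) ∘L R₀ ∘L
      (W : WithLp 2 (H × H) →L[ℂ] WithLp 2 (H × H))
  have hR (v : WithLp 2 (H × H)) : R v = W.symm (R₀ (W v)) := rfl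
  obtain ⟨A, B, C, D, hABCD⟩ := exists_eq_block R
  have hA : A = (1 / 2 : ℂ) • T := by
    ext x
    refine ext_inner_left ℂ fun y => ?_
    have h1 : inner ℂ (WithLp.toLp 2 (y, 0) : WithLp 2 (H × H)) (R (WithLp.toLp 2 (x, 0))) =
        inner ℂ y (A x) := by
      rw [hABCD, block_apply, WithLp.prod_inner_apply]
      simp
    rw [← h1, hR, ← W.inner_map_map, W.apply_symm_apply, hW, hW, hR₀, ← hFG,
      WithLp.prod_inner_apply]
    simp only [add_apply, smul_apply, inner_add_right, mul_apply_eq_comp, inner_smul_right,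
      star_eq_adjoint, adjoint_inner_right]
  subst hA
  refine ⟨B, C, D, ?_, ?_⟩
  · rw [← hABCD]
    refine opNorm_le_bound _ zero_le_one fun v => ?_
    rw [hR, W.symm.norm_map, one_mul]
    exact (hR₀n _).trans (W.norm_map v).le
  · rw [← hABCD]
    ext v
    all_goals
      rw [mul_apply_eq_comp, hR, hR, W.apply_symm_apply, hR₀sq, map_smul, W.symm_apply_apply]
      obtain ⟨x, y⟩ := v
      rw [block_apply, ← WithLp.toLp_smul]
      simp

theorem isUnit_of_isUnit_mul_left [FiniteDimensional ℂ H] {B C : H →L[ℂ] H}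
    (h : IsUnit (B * C)) : IsUnit C := by
  have : CompleteSpace H := FiniteDimensional.complete ℂ H
  rw [isUnit_iff_bijective] at h ⊢
  have hC : Function.Injective C := Function.Injective.of_comp (f := B) h.1
  exact ⟨hC, (LinearMap.injective_iff_surjective (f := (C : H →ₗ[ℂ] H))).1 hC⟩

theorem exists_isContractiveBlock {δ : ℝ} (hδ₀ : 0 < δ) (hδ₁ : δ < 1) {T Q : H →L[ℂ] H}
    (hT : IsGeneric δ T) (hQ : IsRootChoice δ T Q) (hW : numRange T ⊆ ellipse δ) :
    ∃ S : (H →L[ℂ] H)ˣ, IsContractiveBlock T Q S := by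
  have := hT.finiteDimensional
  have : CompleteSpace H := FiniteDimensional.complete ℂ H
  obtain ⟨B, C, D, hn, hsq⟩ := exists_contraction_sq_eq hδ₀ hδ₁ hW
  obtain ⟨q, rfl⟩ := isUnit_of_isRootChoice hT hQ
  rw [block_mul] at hsq
  -- Only the first column of `R² = δ` is needed: `T²/4 + BC = δ` and `CT/2 + DC = 0`.
  obtain ⟨h1, -, h3, -⟩ := block_inj hsq
  have hq2 : (q : H →L[ℂ] H) * q = T * T - (4 * (δ : ℂ)) • (1 : H →L[ℂ] H) := by
    rw [← sq, ← sq, hQ.sq_eq]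
  have hBC : (q : H →L[ℂ] H) * q = (-(2 : ℂ) • B) * ((2 : ℂ) • C) := by
    have e : B * C = (δ : ℂ) • 1 - (1 / 4 : ℂ) • (T * T) := by
      rw [← h1, smul_mul_smul_comm]; norm_num
    rw [hq2, smul_mul_smul_comm, e, smul_sub, smul_smul, smul_smul]
    norm_num
    rw [neg_add_eq_sub]
  have hu : IsUnit ((2 : ℂ) • C) := by
    refine isUnit_of_isUnit_mul_left (B := -(2 : ℂ) • B) ?_
    rw [← hBC]
    exact q.isUnit.mul q.isUnit
  obtain ⟨u, hu⟩ := hu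
  rw [← hu] at hBC
  have hCT : (u : H →L[ℂ] H) * T = (-(2 : ℂ) • D) * u := by
    rw [hu, smul_mul_smul_comm, smul_mul_assoc]
    rw [mul_smul_comm] at h3
    have : C * T = (2 : ℂ) • ((1 / 2 : ℂ) • (C * T)) := by rw [smul_smul]; norm_num
    rw [this, eq_neg_of_add_eq_zero_left h3, smul_neg, smul_neg, smul_smul]
    norm_num
  have hqT : (q : H →L[ℂ] H) * T = T * q := hQ.commute
  -- `S = 2CQ⁻¹` is forced by matching `SQ/2` with `C`; the two column relations then give the
  -- remaining entries `-B` and `-D`.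
  refine ⟨u * q⁻¹, ?_⟩
  have e1 : ((u * q⁻¹ : (H →L[ℂ] H)ˣ) : H →L[ℂ] H) * q = (2 : ℂ) • C := by
    rw [Units.val_mul, mul_assoc, Units.inv_mul, mul_one, hu]
  have e2 : (q : H →L[ℂ] H) * (((u * q⁻¹)⁻¹ : (H →L[ℂ] H)ˣ) : H →L[ℂ] H) = -(2 : ℂ) • B := by
    rw [mul_inv_rev, inv_inv, Units.val_mul, ← mul_assoc, hBC, mul_assoc, Units.mul_inv, mul_one]
  have e3 : ((u * q⁻¹ : (H →L[ℂ] H)ˣ) : H →L[ℂ] H) * T *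
      (((u * q⁻¹)⁻¹ : (H →L[ℂ] H)ˣ) : H →L[ℂ] H) = -(2 : ℂ) • D := by
    rw [mul_inv_rev, inv_inv, Units.val_mul, Units.val_mul]
    calc (u : H →L[ℂ] H) * (q⁻¹ : (H →L[ℂ] H)ˣ) * T * (q * (u⁻¹ : (H →L[ℂ] H)ˣ)) =
        u * ((q⁻¹ : (H →L[ℂ] H)ˣ) * (T * q)) * (u⁻¹ : (H →L[ℂ] H)ˣ) := by simp only [mul_assoc]
      _ = u * T * (u⁻¹ : (H →L[ℂ] H)ˣ) := by rw [← hqT, Units.inv_mul_cancel_left]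
      _ = _ := by rw [hCT, mul_assoc, Units.mul_inv, mul_one]
  rw [IsContractiveBlock, e1, e2, e3]
  have e4 : (1 / 2 : ℂ) • block T (-(2 : ℂ) • B) ((2 : ℂ) • C) (-(2 : ℂ) • D) =
      block ((1 / 2 : ℂ) • T) B C D * block 1 0 0 (-1) := by
    rw [smul_block, block_mul]
    congr 1 <;> simp [smul_smul]
  rw [e4]
  exact (norm_mul_le _ _).trans (mul_le_one₀ hn (norm_nonneg _) norm_block_reflection_le)

end Dilation

end EllipticalRange

/-! ### The equivalences -/

theorem mainTheorem3 {H : Type*} [NormedAddCommGroup H] [InnerProductSpace ℂ H]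
    (δ : ℝ) (hδ₀ : 0 < δ) (hδ₁ : δ < 1)
    (T : H →L[ℂ] H) (hT : EllipticalRange.IsGeneric δ T) :
    (∃ Q : H →L[ℂ] H, EllipticalRange.IsRootChoice δ T Q) ∧
    (∀ Q : H →L[ℂ] H, EllipticalRange.IsRootChoice δ T Q → ∀ S : (H →L[ℂ] H)ˣ,
      (EllipticalRange.IsContractiveConj T Q S ↔ EllipticalRange.IsContractiveBlock T Q S)) ∧
    List.TFAE
      [EllipticalRange.numRange T ⊆ EllipticalRange.ellipse δ,
       ∃ Q : H →L[ℂ] H, EllipticalRange.IsRootChoice δ T Q ∧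
         ∃ S : (H →L[ℂ] H)ˣ, EllipticalRange.IsContractiveConj T Q S,
       ∀ Q : H →L[ℂ] H, EllipticalRange.IsRootChoice δ T Q →
         ∃ S : (H →L[ℂ] H)ˣ, EllipticalRange.IsContractiveConj T Q S,
       ∃ Q : H →L[ℂ] H, EllipticalRange.IsRootChoice δ T Q ∧
         ∃ S : (H →L[ℂ] H)ˣ, EllipticalRange.IsContractiveBlock T Q S,
       ∀ Q : H →L[ℂ] H, EllipticalRange.IsRootChoice δ T Q →
         ∃ S : (H →L[ℂ] H)ˣ, EllipticalRange.IsContractiveBlock T Q S] := by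
  obtain ⟨Q₀, hQ₀⟩ := EllipticalRange.exists_isRootChoice hT
  refine ⟨⟨Q₀, hQ₀⟩,
    fun Q _ S => EllipticalRange.isContractiveConj_iff_isContractiveBlock T Q S, ?_⟩
  have := hT.finiteDimensional
  have : CompleteSpace H := FiniteDimensional.complete ℂ H
  simp only [EllipticalRange.isContractiveConj_iff_isContractiveBlock]
  tfae_have 1 → 5 := fun h Q hQ => EllipticalRange.exists_isContractiveBlock hδ₀ hδ₁ hT hQ h
  tfae_have 5 → 3 := id
  tfae_have 3 → 2 := fun h => ⟨Q₀, hQ₀, h Q₀ hQ₀⟩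
  tfae_have 2 → 4 := id
  tfae_have 4 → 1 := fun ⟨_, hQ, _, hS⟩ =>
    EllipticalRange.numRange_subset_ellipse hδ₀ hδ₁ hQ hS
  tfae_finish
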